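/- Let $E:\ 0\to\mathbb Z\xrightarrow{\iota}G\xrightarrow{\pi}\mathbb R/\mathbb Z\to 0$ range over exact sequences of abelian groups with $G$ divisible and torsion-free; for $x\in G$ and $n\ge 1$ let $x/n$ be the unique $y\in G$ with $ny=x$. View $E$ as a first-order structure $(G,\pi,\mathbb R_{\mathrm{field}})$ with sorts $\mathbb Z$, $G$, $\mathbb R$, the additions of $\mathbb Z$ and $G$, the field operations of $\mathbb R$, and the maps $\iota$ and $\pi:G\to\mathbb R/\mathbb Z=[0,1)\subset\mathbb R$. Let $L_0$ be the language of these structures and let $L$ be $L_0$ together with a constant symbol naming the generator $1$ of the sort $\mathbb Z$. The standard model is $(\mathbb R,\bmod_{\mathbb Z},\mathbb R_{\mathrm{field}})$, given by $0\to\mathbb Z\subset\mathbb R\to\mathbb R/\mathbb Z\to0$. Let $\widehat{\mathbb R/\mathbb Z}$ be the group of sequences $(h_n)_{n\ge1}$ in $\mathbb R/\mathbb Z$ with $k\,h_{nk}=h_n$ for all $n,k\ge1$, and let $\hat\pi:G\to\widehat{\mathbb R/\mathbb Z}$, $\hat\pi(x)=(\pi(x/n))_{n\ge 1}$. (1) $(G,\pi,\mathbb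 R_{\mathrm{field}})$ is elementarily equivalent to the standard model in $L$ if and only if $\pi(\iota(1)/n)=1/n \bmod \mathbb Z$ for every $n\ge1$. (2) For two such sequences $E,E'$: the structures are isomorphic in $L_0$ if and only if $\hat\pi(G)=\hat\pi'(G')$; they are isomorphic in $L$ if and only if $\hat\pi(G)=\hat\pi'(G')$ and $\hat\pi(\iota(1))=\hat\pi'(\iota'(1))$. There is a family of at least $2^{\aleph_0}$ such structures that are pairwise non-isomorphic, even in $L_0$, and all elementarily equivalent to the standard model in $L$. (3) $(G,\pi,\mathbb R_{\mathrm{field}})$ is isomorphic to the standard model in $L_0$ if and only if $G$ carries a topology making it a topological group and $\pi$ a covering map. It is isomorphic to the standard model in $L$ if and only if, in addition, $\pi(\iota(1)/n)=1/n\bmod\mathbb Z$ for every $n\ge1$. -/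

import Mathlib

universe u v

/-- An exact sequence `0 → ℤ → G → ℝ/ℤ → 0` of abelian groups with `G` divisible and
torsion-free. -/
structure CircleExtension : Type (u + 1) where
  /-- the middle group -/
  G : Type u
  [group : AddCommGroup G]
  ι : ℤ →+ G
  π : G →+ UnitAddCircle
  ι_injective : Function.Injective ι
  exact : Function.Exact ι π
  π_surjective : Function.Surjective π
  divisible : ∀ (n : ℕ+) (x : G), ∃ y : G, (n : ℕ) • y = x
  torsionFree : IsAddTorsionFree G

/-- Relation symbols of the language of structures `(Γ, G, M)`. The three-sorted structure is
presented in the usual one-sorted way: the universe is the disjoint union of the sorts, there is a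
unary predicate for each sort, and each operation is given by its graph. -/
inductive CoverRel : ℕ → Type
  | sortΓ : CoverRel 1
  | sortG : CoverRel 1
  | sortM : CoverRel 1
  /-- addition of the kernel sort -/
  | addΓ : CoverRel 3
  /-- addition of the group sort -/
  | addG : CoverRel 3
  /-- addition of the field sort -/
  | addM : CoverRel 3
  /-- multiplication of the field sort -/
  | mulM : CoverRel 3
  /-- the graph of `ι : Γ → G` -/
  | iota : CoverRel 2
  /-- the graph of `π : G → M` -/
  | proj : CoverRel 2

/-- The language of `(Γ, G, M)` without a name for a generator of the kernel. -/
def coverLang₀ : FirstOrder.Language where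
  Functions := fun _ => Empty
  Relations := CoverRel

/-- The language `L`: `coverLang₀` with one new constant symbol, naming a generator of the
kernel. -/
abbrev coverLang : FirstOrder.Language := coverLang₀.withConstants Unit

namespace CircleExtension

attribute [instance] CircleExtension.group

/-- The universe of the structure `(ℤ, G, ℝ)`: the disjoint union of its three sorts. -/
inductive Carrier (E : CircleExtension.{u}) : Type u
  | ker (k : ℤ) : Carrier E
  | grp (g : E.G) : Carrier E
  | fld (r : ℝ) : Carrier E

open Carrier in
/-- The structure `(G, π, ℝ)`, without the named generator. The circle `ℝ/ℤ` is identified with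
`[0,1) ⊆ ℝ`, so `π g` is the unique real `r ∈ [0,1)` whose class is `π g`. -/
instance (E : CircleExtension.{u}) : coverLang₀.Structure E.Carrier where
  funMap := fun f => nomatch f
  RelMap := fun {_} R => match R with
    | .sortΓ => fun x => ∃ k : ℤ, x = ![ker k]
    | .sortG => fun x => ∃ g : E.G, x = ![grp g]
    | .sortM => fun x => ∃ r : ℝ, x = ![fld r]
    | .addΓ => fun x => ∃ k l : ℤ, x = ![ker k, ker l, ker (k + l)]
    | .addG => fun x => ∃ g h : E.G, x = ![grp g, grp h, grp (g + h)]
    | .addM => fun x => ∃ r s : ℝ, x = ![fld r, fld s, fld (r + s)]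
    | .mulM => fun x => ∃ r s : ℝ, x = ![fld r, fld s, fld (r * s)]
    | .iota => fun x => ∃ k : ℤ, x = ![ker k, grp (E.ι k)]
    | .proj => fun x => ∃ (g : E.G) (r : ℝ), r ∈ Set.Ico (0 : ℝ) 1 ∧
        (r : UnitAddCircle) = E.π g ∧ x = ![grp g, fld r]

/-- The new constant symbol names the generator `1` of the kernel `ℤ`. -/
instance (E : CircleExtension.{u}) :
    (FirstOrder.Language.constantsOn Unit).Structure E.Carrier :=
  FirstOrder.Language.constantsOn.structure fun _ => Carrier.ker 1

/-- `E` and `E'` are isomorphic in the language `L` (the generator of the kernel is named). -/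
def Iso (E : CircleExtension.{u}) (E' : CircleExtension.{v}) : Prop :=
  Nonempty (coverLang.Equiv E.Carrier E'.Carrier)

/-- `E` and `E'` are isomorphic in the language without a name for a generator of the kernel. -/
def Iso₀ (E : CircleExtension.{u}) (E' : CircleExtension.{v}) : Prop :=
  Nonempty (coverLang₀.Equiv E.Carrier E'.Carrier)

/-- `E` and `E'` are elementarily equivalent in the language `L`. -/
def ElemEquiv (E : CircleExtension.{u}) (E' : CircleExtension.{v}) : Prop :=
  coverLang.ElementarilyEquivalent E.Carrier E'.Carrier

/-- The universal cover `0 → ℤ → ℝ → ℝ/ℤ → 0` of the circle. -/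
noncomputable def standard : CircleExtension.{0} where
  G := ℝ
  ι := Int.castAddHom ℝ
  π := QuotientAddGroup.mk' (AddSubgroup.zmultiples (1 : ℝ))
  ι_injective := Int.cast_injective
  exact := by
    intro x
    rw [← AddMonoidHom.mem_ker, QuotientAddGroup.ker_mk', AddSubgroup.mem_zmultiples_iff]
    simp
  π_surjective := QuotientAddGroup.mk'_surjective _
  divisible := fun n x => ⟨x / (n : ℕ), by
    have : ((n : ℕ) : ℝ) ≠ 0 := by exact_mod_cast n.ne_zero
    rw [nsmul_eq_mul]
    field_simp⟩
  torsionFree := inferInstance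

/-- Division by `n` in the divisible torsion-free group `G`: the unique `y` with `n • y = x`. -/
noncomputable def divBy (E : CircleExtension.{u}) (x : E.G) (n : ℕ+) : E.G :=
  Classical.choose (E.divisible n x)

theorem nsmul_divBy (E : CircleExtension.{u}) (x : E.G) (n : ℕ+) :
    (n : ℕ) • E.divBy x n = x :=
  Classical.choose_spec (E.divisible n x)

theorem divBy_unique (E : CircleExtension.{u}) (x y : E.G) (n : ℕ+) (h : (n : ℕ) • y = x) :
    y = E.divBy x n := by
  have := E.torsionFree
  exact nsmul_right_injective n.ne_zero (h.trans (E.nsmul_divBy x n).symm)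

end CircleExtension

/-- The inverse limit of the maps `k : ℝ/ℤ → ℝ/ℤ`, `x ↦ k x`, for `k ≥ 1`: all sequences
`(hₙ)` with `k hₙₖ = hₙ`. -/
def CircleHat : AddSubgroup (ℕ+ → UnitAddCircle) where
  carrier := {h | ∀ n k : ℕ+, (k : ℕ) • h (n * k) = h n}
  zero_mem' := by intro n k; simp
  add_mem' := by
    intro a b ha hb n k
    simp only [Pi.add_apply, nsmul_add, ha n k, hb n k]
  neg_mem' := by
    intro a ha n k
    simp only [Pi.neg_apply, smul_neg, ha n k]

/-- The map `π̂ : G → lim ℝ/ℤ`, `x ↦ (π (x / n))ₙ`. -/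
noncomputable def CircleExtension.piHat (E : CircleExtension.{u}) (x : E.G) : CircleHat :=
  ⟨fun n => E.π (E.divBy x n), fun n k => by
    rw [← map_nsmul]
    congr 1
    apply E.divBy_unique
    rw [← mul_nsmul', ← PNat.mul_coe, E.nsmul_divBy]⟩

/-!
The group `G` of an extension embeds into the solenoid `lim ℝ/ℤ` by `π̂`: an element of the kernel
of `π̂` is an integer divisible by all positive integers. The field `ℝ` has no automorphisms, so an
isomorphism of structures is a group isomorphism `f : G ≃ G'` with `π' ∘ f = π`
(`exists_addEquiv_of_equiv`, `iso₀_iff`, `iso_iff`), and such an `f` is the same thing as an equality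
of the images of `π̂` and `π̂'` (`range_piHat_eq_iff`).

Elementary equivalence is shown by an Ehrenfeucht–Fraïssé game. Two tuples are similar up to height
`N` if their sorts and their real entries agree, and the attached elements of the middle groups have
the same fractions over the circle for denominators up to `N` and the same linear relations with
coefficients up to `N`. Similarity up to height `2 N ^ 2` can be extended to any further element
keeping similarity up to height `N` (`Approx.exists_extend`): a dependent element is determined by
its relation, and for an independent one surjectivity of `π'` yields infinitely many candidates, all
but finitely many of which are independent as well. By induction each formula is decided by the
similarity class up to some height (`exists_realize_iff`), whence elementary equivalence as soon as
the fractions of the generators lie over the same points (`elemEquiv_of_forall_π_divBy`). Conversely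
the point below a fraction of the generator is described by a formula (`fractionFormula`).

For non-isomorphic models of the theory of the standard one, the projection `ℝ → ℝ/ℤ` is changed by
a homomorphism `ψ` from `ℝ/ℚ` to the torsion of the circle (`twist`). An isomorphism between the
twists by `ψ` and `ψ'` forces `ψ - ψ'` to be, along each line `ℚ x`, a rational multiple of the
reduction modulo `ℤ` (`exists_rat_of_iso₀_twist`). Composing a character of `ℚ` that is no such
multiple with the linear forms `ℝ/ℚ → ℚ` that are `0` or `1` on the members of a basis gives
pairwise non-isomorphic twists, one for each subset of the basis (`exists_many_twists`).

If `π` is a covering map of topological groups, the universal covering `ℝ → ℝ/ℤ` lifts to a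
homomorphism `ℝ → G`. Because `G` is torsion-free and `π` has kernel `ℤ`, the lift is bijective
(`bijective_of_lift`), so that `G` is isomorphic to the standard extension.
-/

namespace CircleExtension

open FirstOrder

variable {E : CircleExtension.{u}} {E' : CircleExtension.{v}}

/-! ### The relations of the language, and isomorphisms -/

section RelMap

open Carrier FirstOrder.Language.Structure

theorem relMap_sortΓ {x : Fin 1 → E.Carrier} :
    RelMap (L := coverLang₀) CoverRel.sortΓ x ↔ ∃ k, x 0 = ker k := by
  refine exists_congr fun k => ?_
  simp [funext_iff]

theorem relMap_sortG {x : Fin 1 → E.Carrier} :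
    RelMap (L := coverLang₀) CoverRel.sortG x ↔ ∃ g, x 0 = grp g := by
  refine exists_congr fun k => ?_
  simp [funext_iff]

theorem relMap_sortM {x : Fin 1 → E.Carrier} :
    RelMap (L := coverLang₀) CoverRel.sortM x ↔ ∃ r, x 0 = fld r := by
  refine exists_congr fun k => ?_
  simp [funext_iff]

theorem relMap_addΓ {x : Fin 3 → E.Carrier} :
    RelMap (L := coverLang₀) CoverRel.addΓ x ↔
      ∃ k l, x 0 = ker k ∧ x 1 = ker l ∧ x 2 = ker (k + l) := by
  refine exists_congr fun k => exists_congr fun l => ?_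
  simp [funext_iff, Fin.forall_fin_succ]

theorem relMap_addG {x : Fin 3 → E.Carrier} :
    RelMap (L := coverLang₀) CoverRel.addG x ↔
      ∃ k l, x 0 = grp k ∧ x 1 = grp l ∧ x 2 = grp (k + l) := by
  refine exists_congr fun k => exists_congr fun l => ?_
  simp [funext_iff, Fin.forall_fin_succ]

theorem relMap_addM {x : Fin 3 → E.Carrier} :
    RelMap (L := coverLang₀) CoverRel.addM x ↔
      ∃ k l, x 0 = fld k ∧ x 1 = fld l ∧ x 2 = fld (k + l) := by
  refine exists_congr fun k => exists_congr fun l => ?_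
  simp [funext_iff, Fin.forall_fin_succ]

theorem relMap_mulM {x : Fin 3 → E.Carrier} :
    RelMap (L := coverLang₀) CoverRel.mulM x ↔
      ∃ k l, x 0 = fld k ∧ x 1 = fld l ∧ x 2 = fld (k * l) := by
  refine exists_congr fun k => exists_congr fun l => ?_
  simp [funext_iff, Fin.forall_fin_succ]

theorem relMap_iota {x : Fin 2 → E.Carrier} :
    RelMap (L := coverLang₀) CoverRel.iota x ↔ ∃ k, x 0 = ker k ∧ x 1 = grp (E.ι k) := by
  refine exists_congr fun k => ?_
  simp [funext_iff, Fin.forall_fin_succ]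

theorem relMap_proj {x : Fin 2 → E.Carrier} :
    RelMap (L := coverLang₀) CoverRel.proj x ↔ ∃ (g : E.G) (r : ℝ), r ∈ Set.Ico (0 : ℝ) 1 ∧
      (r : UnitAddCircle) = E.π g ∧ x 0 = grp g ∧ x 1 = fld r := by
  refine exists_congr fun k => exists_congr fun r => ?_
  simp [funext_iff, Fin.forall_fin_succ]

end RelMap

theorem exists_Ico_coe_eq (c : UnitAddCircle) :
    ∃ r ∈ Set.Ico (0 : ℝ) 1, (r : UnitAddCircle) = c :=
  ⟨(AddCircle.equivIco 1 0 c : ℝ), by simpa using (AddCircle.equivIco 1 0 c).2,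
    (AddCircle.equivIco 1 0).symm_apply_apply c⟩

theorem π_ι (k : ℤ) : E.π (E.ι k) = 0 :=
  (E.exact _).2 ⟨k, rfl⟩

open Carrier FirstOrder.Language.Structure in
/-- An isomorphism of structures acts on the field sort by a ring automorphism of `ℝ`, hence
trivially; so what is left of it is its action on the middle group. -/
theorem exists_addEquiv_of_equiv (e : coverLang₀.Equiv E.Carrier E'.Carrier) :
    ∃ f : E.G ≃+ E'.G, (∀ x, E'.π (f x) = E.π x) ∧
      ∀ k k', e (ker k) = ker k' → f (E.ι k) = E'.ι k' := by
  have rel {n : ℕ} (R : CoverRel n) (x : Fin n → E.Carrier) := e.map_rel' R x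
  have hker (k : ℤ) : ∃ k', e (ker k) = ker k' :=
    relMap_sortΓ.1 ((rel .sortΓ ![ker k]).2 (relMap_sortΓ.2 ⟨k, rfl⟩))
  have hgrp (g : E.G) : ∃ g', e (grp g) = grp g' :=
    relMap_sortG.1 ((rel .sortG ![grp g]).2 (relMap_sortG.2 ⟨g, rfl⟩))
  have hfld (r : ℝ) : ∃ r', e (fld r) = fld r' :=
    relMap_sortM.1 ((rel .sortM ![fld r]).2 (relMap_sortM.2 ⟨r, rfl⟩))
  choose κ hκ using hker
  choose f hf using hgrp
  choose ρ hρ using hfld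
  have hρinj : Function.Injective ρ := fun a b h => by
    have : e (fld a) = e (fld b) := by rw [hρ, hρ, h]
    simpa using e.injective this
  have hρadd (r s : ℝ) : ρ (r + s) = ρ r + ρ s := by
    obtain ⟨k, l, h0, h1, h2⟩ := relMap_addM.1
      ((rel .addM ![fld r, fld s, fld (r + s)]).2 (relMap_addM.2 ⟨r, s, rfl, rfl, rfl⟩))
    replace h0 : e (fld r) = fld k := h0
    replace h1 : e (fld s) = fld l := h1
    replace h2 : e (fld (r + s)) = fld (k + l) := h2
    rw [hρ] at h0 h1 h2
    injection h0; injection h1; injection h2; simp_all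
  have hρmul (r s : ℝ) : ρ (r * s) = ρ r * ρ s := by
    obtain ⟨k, l, h0, h1, h2⟩ := relMap_mulM.1
      ((rel .mulM ![fld r, fld s, fld (r * s)]).2 (relMap_mulM.2 ⟨r, s, rfl, rfl, rfl⟩))
    replace h0 : e (fld r) = fld k := h0
    replace h1 : e (fld s) = fld l := h1
    replace h2 : e (fld (r * s)) = fld (k * l) := h2
    rw [hρ] at h0 h1 h2
    injection h0; injection h1; injection h2; simp_all
  have hρ0 : ρ 0 = 0 := by simpa using hρadd 0 0
  have hρ1 : ρ 1 = 1 := by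
    have h : ρ 1 ≠ 0 := fun h => one_ne_zero (hρinj (h.trans hρ0.symm))
    have := hρmul 1 1
    rw [mul_one] at this
    exact (mul_eq_left₀ h).1 this.symm
  have hρid (r : ℝ) : ρ r = r := by
    let φ : ℝ →+* ℝ :=
      { toFun := ρ, map_one' := hρ1, map_mul' := hρmul, map_zero' := hρ0, map_add' := hρadd }
    exact DFunLike.congr_fun (Subsingleton.elim φ (RingHom.id ℝ)) r
  have hfadd (x y : E.G) : f (x + y) = f x + f y := by
    obtain ⟨k, l, h0, h1, h2⟩ := relMap_addG.1
      ((rel .addG ![grp x, grp y, grp (x + y)]).2 (relMap_addG.2 ⟨x, y, rfl, rfl, rfl⟩))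
    replace h0 : e (grp x) = grp k := h0
    replace h1 : e (grp y) = grp l := h1
    replace h2 : e (grp (x + y)) = grp (k + l) := h2
    rw [hf] at h0 h1 h2
    injection h0; injection h1; injection h2; simp_all
  have hfinj : Function.Injective f := fun a b h => by
    have : e (grp a) = e (grp b) := by rw [hf, hf, h]
    simpa using e.injective this
  have hfsurj : Function.Surjective f := fun y => by
    obtain ⟨x, hx⟩ := e.surjective (grp y)
    cases x with
    | ker k => rw [hκ] at hx; cases hx
    | fld r => rw [hρ] at hx; cases hx
    | grp g => exact ⟨g, by simpa [hf] using hx⟩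
  refine ⟨AddEquiv.ofBijective (AddMonoidHom.mk' f hfadd) ⟨hfinj, hfsurj⟩, fun x => ?_,
    fun k k' h => ?_⟩
  · obtain ⟨r, hr, hrx⟩ := exists_Ico_coe_eq (E.π x)
    obtain ⟨g, s, -, hs, h0, h1⟩ := relMap_proj.1
      ((rel .proj ![grp x, fld r]).2 (relMap_proj.2 ⟨x, r, hr, hrx, rfl, rfl⟩))
    replace h0 : e (grp x) = grp g := h0
    replace h1 : e (fld r) = fld s := h1
    rw [hf] at h0
    rw [hρ, hρid] at h1
    injection h0 with h0; injection h1 with h1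
    subst h1
    exact (congrArg E'.π h0).trans (hs.symm.trans hrx)
  · obtain ⟨k'', h0, h1⟩ := relMap_iota.1
      ((rel .iota ![ker k, grp (E.ι k)]).2 (relMap_iota.2 ⟨k, rfl, rfl⟩))
    replace h0 : e (ker k) = ker k'' := h0
    replace h1 : e (grp (E.ι k)) = grp (E'.ι k'') := h1
    rw [h] at h0
    rw [hf] at h1
    injection h0 with h0; injection h1 with h1
    subst h0
    exact h1

/-- A group isomorphism over the circle restricts to the kernels. -/
theorem exists_kerEquiv (f : E.G ≃+ E'.G) (hf : ∀ x, E'.π (f x) = E.π x) :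
    ∃ κ : ℤ ≃+ ℤ, ∀ k, E'.ι (κ k) = f (E.ι k) := by
  have h1 (k : ℤ) : ∃ l, E'.ι l = f (E.ι k) := (E'.exact _).1 (by rw [hf, π_ι])
  have h2 (l : ℤ) : ∃ k, E.ι k = f.symm (E'.ι l) :=
    (E.exact _).1 (by rw [← hf, f.apply_symm_apply, π_ι])
  choose κ hκ using h1
  choose μ hμ using h2
  exact ⟨
    { toFun := κ
      invFun := μ
      left_inv := fun k => E.ι_injective (by rw [hμ, hκ, f.symm_apply_apply])
      right_inv := fun k => E'.ι_injective (by rw [hκ, hμ, f.apply_symm_apply])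
      map_add' := fun k l => E'.ι_injective (by simp only [hκ, map_add]) }, hκ⟩

open Carrier in
/-- The bijection of universes given by bijections of the kernel and group sorts, and the identity
of the field sort. -/
def carrierEquiv (κ : ℤ ≃+ ℤ) (f : E.G ≃+ E'.G) : E.Carrier ≃ E'.Carrier where
  toFun
    | ker k => ker (κ k)
    | grp g => grp (f g)
    | fld r => fld r
  invFun
    | ker k => ker (κ.symm k)
    | grp g => grp (f.symm g)
    | fld r => fld r
  left_inv x := by cases x <;> simp
  right_inv x := by cases x <;> simp

section carrierEquiv

open Carrier

variable (κ : ℤ ≃+ ℤ) (f : E.G ≃+ E'.G) (x : E.Carrier)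

theorem carrierEquiv_eq_ker (k : ℤ) : carrierEquiv κ f x = ker k ↔ x = ker (κ.symm k) := by
  rw [← Equiv.eq_symm_apply]; rfl

theorem carrierEquiv_eq_grp (g : E'.G) : carrierEquiv κ f x = grp g ↔ x = grp (f.symm g) := by
  rw [← Equiv.eq_symm_apply]; rfl

theorem carrierEquiv_eq_fld (r : ℝ) : carrierEquiv κ f x = fld r ↔ x = fld r := by
  rw [← Equiv.eq_symm_apply]; rfl

end carrierEquiv

/-- The isomorphism of structures given by a group isomorphism over the circle. -/
def structureEquiv (κ : ℤ ≃+ ℤ) (f : E.G ≃+ E'.G) (hf : ∀ x, E'.π (f x) = E.π x)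
    (hκ : ∀ k, E'.ι (κ k) = f (E.ι k)) : coverLang₀.Equiv E.Carrier E'.Carrier where
  toEquiv := carrierEquiv κ f
  map_fun' := fun φ => nomatch φ
  map_rel' := fun {n} R x => by
    have hf' (x) : E.π (f.symm x) = E'.π x := by rw [← hf, f.apply_symm_apply]
    have hκ' (k) : E.ι (κ.symm k) = f.symm (E'.ι k) := by
      rw [f.eq_symm_apply, ← hκ, κ.apply_symm_apply]
    cases R
    · simp only [relMap_sortΓ, Function.comp_apply, Equiv.toFun_as_coe, carrierEquiv_eq_ker]
      exact κ.symm.surjective.exists (p := fun k => x 0 = Carrier.ker k) |>.symm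
    · simp only [relMap_sortG, Function.comp_apply, Equiv.toFun_as_coe, carrierEquiv_eq_grp]
      exact f.symm.surjective.exists (p := fun k => x 0 = Carrier.grp k) |>.symm
    · simp only [relMap_sortM, Function.comp_apply, Equiv.toFun_as_coe, carrierEquiv_eq_fld]
    · simp only [relMap_addΓ, Function.comp_apply, Equiv.toFun_as_coe, carrierEquiv_eq_ker, map_add]
      exact (κ.symm.surjective.exists.trans
        (exists_congr fun k => κ.symm.surjective.exists)).symm
    · simp only [relMap_addG, Function.comp_apply, Equiv.toFun_as_coe, carrierEquiv_eq_grp, map_add]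
      exact (f.symm.surjective.exists.trans
        (exists_congr fun k => f.symm.surjective.exists)).symm
    · simp only [relMap_addM, Function.comp_apply, Equiv.toFun_as_coe, carrierEquiv_eq_fld]
    · simp only [relMap_mulM, Function.comp_apply, Equiv.toFun_as_coe, carrierEquiv_eq_fld]
    · simp only [relMap_iota, Function.comp_apply, Equiv.toFun_as_coe, carrierEquiv_eq_grp,
        carrierEquiv_eq_ker, ← hκ']
      exact (κ.symm.surjective.exists (p := fun k => x 0 = .ker k ∧ x 1 = .grp (E.ι k))).symm
    · simp only [relMap_proj, Function.comp_apply, Equiv.toFun_as_coe, carrierEquiv_eq_grp,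
        carrierEquiv_eq_fld, ← hf']
      exact (f.symm.surjective.exists (p := fun g => ∃ r : ℝ, r ∈ Set.Ico (0 : ℝ) 1 ∧
        (r : UnitAddCircle) = E.π g ∧ x 0 = .grp g ∧ x 1 = .fld r)).symm

theorem iso₀_iff : E.Iso₀ E' ↔ ∃ f : E.G ≃+ E'.G, ∀ x, E'.π (f x) = E.π x := by
  constructor
  · rintro ⟨e⟩
    obtain ⟨f, hf, -⟩ := exists_addEquiv_of_equiv e
    exact ⟨f, hf⟩
  · rintro ⟨f, hf⟩
    obtain ⟨κ, hκ⟩ := exists_kerEquiv f hf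
    exact ⟨structureEquiv κ f hf hκ⟩

theorem iso_iff : E.Iso E' ↔
    ∃ f : E.G ≃+ E'.G, (∀ x, E'.π (f x) = E.π x) ∧ f (E.ι 1) = E'.ι 1 := by
  constructor
  · rintro ⟨e⟩
    let e₀ : coverLang₀.Equiv E.Carrier E'.Carrier :=
      { e.toEquiv with
        map_fun' := fun φ => nomatch φ
        map_rel' := fun R x => e.map_rel' (Sum.inl R) x }
    obtain ⟨f, hf, h⟩ := exists_addEquiv_of_equiv e₀
    refine ⟨f, hf, h 1 1 ?_⟩
    exact (e.map_fun' (Sum.inr () : coverLang.Functions 0) ![])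
  · rintro ⟨f, hf, h1⟩
    obtain ⟨κ, hκ⟩ := exists_kerEquiv f hf
    have hκ1 : κ 1 = 1 := E'.ι_injective (by rw [hκ, h1])
    let e := structureEquiv κ f hf hκ
    refine ⟨{ e.toEquiv with
      map_fun' := fun {n} φ x => ?_
      map_rel' := fun R x => ?_ }⟩
    · rcases φ with φ | φ
      · exact nomatch φ
      · match n, φ with
        | 0, _ => exact congrArg Carrier.ker hκ1
    · rcases R with R | R
      · exact e.map_rel' R x
      · exact nomatch R

/-! ### The profinite lift of the projection -/

instance : IsAddTorsionFree E.G := E.torsionFree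

theorem nsmul_cancel {n : ℕ} (hn : n ≠ 0) {x y : E.G} (h : n • x = n • y) : x = y :=
  nsmul_right_injective hn h

theorem divBy_one (x : E.G) : E.divBy x 1 = x := by
  simpa using E.nsmul_divBy x 1

theorem divBy_add (x y : E.G) (n : ℕ+) : E.divBy (x + y) n = E.divBy x n + E.divBy y n :=
  (E.divBy_unique _ _ n (by rw [nsmul_add, nsmul_divBy, nsmul_divBy])).symm

theorem piHat_apply (x : E.G) (n : ℕ+) : (E.piHat x : ℕ+ → UnitAddCircle) n = E.π (E.divBy x n) :=
  rfl

theorem piHat_add (x y : E.G) : E.piHat (x + y) = E.piHat x + E.piHat y := by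
  ext n
  simp [piHat_apply, divBy_add]

/-- An element of the kernel of `π̂` is an integer all of whose fractions are integers. -/
theorem piHat_injective : Function.Injective E.piHat := by
  have key : ∀ x : E.G, E.piHat x = 0 → x = 0 := fun x hx => by
    have h (n : ℕ+) : ∃ k, E.ι k = E.divBy x n := by
      refine (E.exact _).1 ?_
      rw [← piHat_apply, hx]
      rfl
    obtain ⟨k, hk⟩ := h 1
    rw [divBy_one] at hk
    by_contra hne
    have hk0 : k ≠ 0 := by rintro rfl; exact hne (by rw [← hk, map_zero])
    obtain ⟨l, hl⟩ := h ⟨2 * k.natAbs, by positivity⟩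
    have := E.nsmul_divBy x ⟨2 * k.natAbs, by positivity⟩
    rw [← hl, ← hk, ← map_nsmul] at this
    have := E.ι_injective this
    simp only [PNat.mk_coe, nsmul_eq_mul, Nat.cast_mul, Nat.cast_ofNat, Int.natCast_natAbs] at this
    rcases abs_choice k with h | h <;> rw [h] at this
    · have : k * (2 * l - 1) = 0 := by linarith
      rcases mul_eq_zero.1 this with h | h <;> omega
    · have : k * (2 * l + 1) = 0 := by linarith
      rcases mul_eq_zero.1 this with h | h <;> omega
  let p : E.G →+ CircleHat := AddMonoidHom.mk' E.piHat piHat_add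
  exact (injective_iff_map_eq_zero p).2 key

theorem piHat_map (f : E.G →+ E'.G) (hf : ∀ x, E'.π (f x) = E.π x) (x : E.G) :
    E'.piHat (f x) = E.piHat x := by
  ext n
  rw [piHat_apply, piHat_apply, ← hf]
  congr 1
  exact (E'.divBy_unique _ _ n (by rw [← map_nsmul, nsmul_divBy])).symm

theorem π_eq_of_piHat_eq {x : E.G} {y : E'.G} (h : E'.piHat y = E.piHat x) : E'.π y = E.π x := by
  have := congrArg (fun a : CircleHat => (a : ℕ+ → UnitAddCircle) 1) h
  simpa only [piHat_apply, divBy_one] using this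

theorem range_piHat_eq_iff : Set.range E.piHat = Set.range E'.piHat ↔
    ∃ f : E.G ≃+ E'.G, ∀ x, E'.π (f x) = E.π x := by
  constructor
  · intro h
    have h1 (x : E.G) : ∃ y, E'.piHat y = E.piHat x := by
      have := Set.mem_range_self (f := E.piHat) x
      rwa [h] at this
    have h2 (y : E'.G) : ∃ x, E.piHat x = E'.piHat y := by
      have := Set.mem_range_self (f := E'.piHat) y
      rwa [← h] at this
    choose f hf using h1
    choose g hg using h2
    exact ⟨
      { toFun := f
        invFun := g
        left_inv := fun x => piHat_injective (by rw [hg, hf])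
        right_inv := fun x => piHat_injective (by rw [hf, hg])
        map_add' := fun x y => piHat_injective (by simp only [hf, piHat_add]) },
      fun x => π_eq_of_piHat_eq (hf x)⟩
  · rintro ⟨f, hf⟩
    have := piHat_map f.toAddMonoidHom hf
    rw [← f.surjective.range_comp E'.piHat]
    exact congrArg Set.range (funext fun x => (this x).symm)

theorem iso₀_iff_range_piHat : E.Iso₀ E' ↔ Set.range E.piHat = Set.range E'.piHat := by
  rw [iso₀_iff, range_piHat_eq_iff]

theorem iso_iff_range_piHat : E.Iso E' ↔ Set.range E.piHat = Set.range E'.piHat ∧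
    E.piHat (E.ι 1) = E'.piHat (E'.ι 1) := by
  rw [iso_iff, range_piHat_eq_iff]
  constructor
  · rintro ⟨f, hf, h1⟩
    exact ⟨⟨f, hf⟩, by rw [← h1]; exact (piHat_map f.toAddMonoidHom hf _).symm⟩
  · rintro ⟨⟨f, hf⟩, h1⟩
    exact ⟨f, hf, piHat_injective ((piHat_map f.toAddMonoidHom hf _).trans h1)⟩

/-! ### Elementary equivalence by finite approximations -/

section Approx

variable {J : Type*} [Fintype J]

/-- Two families in the middle groups agree up to height `N`: their fractions with denominator at
most `N` lie over the same points of the circle, and they satisfy the same integral linear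
relations with coefficients at most `N`. -/
structure Approx (N : ℕ) (a : J → E.G) (a' : J → E'.G) : Prop where
  frac : ∀ n : ℕ+, (n : ℕ) ≤ N → ∀ j, E.π (E.divBy (a j) n) = E'.π (E'.divBy (a' j) n)
  rel : ∀ m : J → ℤ, (∀ j, |m j| ≤ N) → (∑ j, m j • a j = 0 ↔ ∑ j, m j • a' j = 0)

theorem Approx.symm {N : ℕ} {a : J → E.G} {a' : J → E'.G} (h : Approx N a a') : Approx N a' a :=
  ⟨fun n hn j => (h.frac n hn j).symm, fun m hm => (h.rel m hm).symm⟩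

theorem Approx.mono {M N : ℕ} {a : J → E.G} {a' : J → E'.G} (h : Approx N a a') (hMN : M ≤ N) :
    Approx M a a' :=
  ⟨fun n hn j => h.frac n (hn.trans hMN) j,
    fun m hm => h.rel m fun j => (hm j).trans (by exact_mod_cast hMN)⟩

theorem divBy_sum_zsmul (m : J → ℤ) (a : J → E.G) (n : ℕ+) :
    E.divBy (∑ j, m j • a j) n = ∑ j, m j • E.divBy (a j) n := by
  refine (E.divBy_unique _ _ n ?_).symm
  rw [Finset.smul_sum]
  refine Finset.sum_congr rfl fun j _ => ?_
  rw [smul_comm, nsmul_divBy]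

theorem divBy_zero (n : ℕ+) : E.divBy 0 n = 0 :=
  (E.divBy_unique _ _ n (smul_zero _)).symm

theorem divBy_mul (x y : E.G) (c n : ℕ+) (h : (c : ℕ) • x = y) :
    E.divBy x n = E.divBy y (c * n) := by
  refine E.divBy_unique _ _ _ ?_
  rw [PNat.mul_coe, mul_nsmul', nsmul_divBy, h]

theorem divBy_nsmul (y : E.G) (n : ℕ+) (k N : ℕ) (h : n * k = N) :
    E.divBy (N • y) n = k • y :=
  (E.divBy_unique _ _ n (by rw [← h, mul_nsmul'])).symm

/-- A point that depends on a family can be eliminated from a linear relation. -/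
theorem sum_zsmul_add_eq_zero_iff {a : J → E.G} {x : E.G} {c : ℕ+} {m : J → ℤ}
    (hx : (c : ℕ) • x = ∑ j, m j • a j) {l : J → ℤ} {d : ℤ} :
    ∑ j, l j • a j + d • x = 0 ↔ ∑ j, ((c : ℤ) * l j + d * m j) • a j = 0 := by
  rw [← smul_eq_zero_iff_right (c.ne_zero : (c : ℕ) ≠ 0), nsmul_add, smul_comm _ d x, hx,
    Finset.smul_sum, Finset.smul_sum, ← Finset.sum_add_distrib]
  simp only [add_smul, mul_smul, natCast_zsmul]

/-- Extension of an approximation by a point that depends on the given family. -/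
theorem Approx.exists_extend_of_dependent {N : ℕ} {a : J → E.G} {a' : J → E'.G}
    (h : Approx (2 * N ^ 2) a a') (x : E.G) (c : ℕ+) (hc : (c : ℕ) ≤ N) (m : J → ℤ)
    (hm : ∀ j, |m j| ≤ N) (hx : (c : ℕ) • x = ∑ j, m j • a j) :
    ∃ x' : E'.G, (∀ n : ℕ+, (n : ℕ) ≤ N → E.π (E.divBy x n) = E'.π (E'.divBy x' n)) ∧
      ∀ (l : J → ℤ) (d : ℤ), (∀ j, |l j| ≤ N) → |d| ≤ N →
        (∑ j, l j • a j + d • x = 0 ↔ ∑ j, l j • a' j + d • x' = 0) := by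
  refine ⟨E'.divBy (∑ j, m j • a' j) c, fun n hn => ?_, fun l d hl hd => ?_⟩
  · rw [divBy_mul x _ c n hx, divBy_mul _ _ c n (nsmul_divBy _ _ _), divBy_sum_zsmul,
      divBy_sum_zsmul, map_sum, map_sum]
    refine Finset.sum_congr rfl fun j _ => ?_
    rw [map_zsmul, map_zsmul, h.frac (c * n)]
    rw [PNat.mul_coe]
    nlinarith
  · rw [sum_zsmul_add_eq_zero_iff hx, sum_zsmul_add_eq_zero_iff (nsmul_divBy _ _ _)]
    refine h.rel _ fun j => ?_
    have hc' : |((c : ℕ) : ℤ)| ≤ N := by rw [Nat.abs_cast]; exact_mod_cast hc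
    calc |((c : ℕ) : ℤ) * l j + d * m j|
        ≤ |((c : ℕ) : ℤ) * l j| + |d * m j| := abs_add_le _ _
      _ = |((c : ℕ) : ℤ)| * |l j| + |d| * |m j| := by rw [abs_mul, abs_mul]
      _ ≤ N * N + N * N := by
        gcongr
        · exact hl j
        · exact hm j
      _ = ((2 * N ^ 2 : ℕ) : ℤ) := by push_cast; ring

/-- Extension of an approximation by a point that satisfies no relation of height `N` over the
given family. The requirement on fractions determines the new point up to `N!` times the kernel,
and only finitely many points satisfy one of the relations to be avoided. -/
theorem Approx.exists_extend_of_independent {N : ℕ} {a : J → E.G} {a' : J → E'.G}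
    (h : Approx N a a') (x : E.G)
    (hx : ∀ (c : ℕ+) (m : J → ℤ), (c : ℕ) ≤ N → (∀ j, |m j| ≤ N) →
      (c : ℕ) • x ≠ ∑ j, m j • a j) :
    ∃ x' : E'.G, (∀ n : ℕ+, (n : ℕ) ≤ N → E.π (E.divBy x n) = E'.π (E'.divBy x' n)) ∧
      ∀ (l : J → ℤ) (d : ℤ), (∀ j, |l j| ≤ N) → |d| ≤ N →
        (∑ j, l j • a j + d • x = 0 ↔ ∑ j, l j • a' j + d • x' = 0) := by
  classical
  let F : ℕ+ := ⟨N.factorial, N.factorial_pos⟩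
  obtain ⟨y, hy⟩ := E'.π_surjective (E.π (E.divBy x F))
  let X (t : ℕ) : E'.G := N.factorial • (y + E'.ι t)
  have hX : Function.Injective X := fun s t hst => by
    have := E'.ι_injective (add_left_cancel (nsmul_cancel N.factorial_ne_zero hst))
    exact_mod_cast this
  have hfrac (t : ℕ) (n : ℕ+) (hn : (n : ℕ) ≤ N) :
      E.π (E.divBy x n) = E'.π (E'.divBy (X t) n) := by
    obtain ⟨k, hk⟩ := Nat.dvd_factorial n.pos hn
    rw [divBy_nsmul _ n k _ hk.symm, map_nsmul, map_add, π_ι, add_zero, hy, ← map_nsmul]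
    congr 1
    refine (E.divBy_unique _ _ n ?_).symm
    rw [← mul_nsmul', ← hk]
    exact E.nsmul_divBy x F
  have hindep (l : J → ℤ) (d : ℤ) (hl : ∀ j, |l j| ≤ N) (hd : |d| ≤ N) (hd0 : d ≠ 0) :
      ∑ j, l j • a j + d • x ≠ 0 := fun h0 => by
    rcases hd0.lt_or_gt with hneg | hpos
    · refine hx ⟨d.natAbs, by omega⟩ l (by rw [PNat.mk_coe]; zify; exact hd) hl ?_
      rw [PNat.mk_coe, ← natCast_zsmul, Int.natCast_natAbs, abs_of_neg hneg, neg_smul]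
      exact (eq_neg_of_add_eq_zero_left h0).symm
    · refine hx ⟨d.natAbs, by omega⟩ (-l) (by rw [PNat.mk_coe]; zify; exact hd)
        (by simpa using hl) ?_
      rw [PNat.mk_coe, ← natCast_zsmul, Int.natCast_natAbs, abs_of_pos hpos]
      simp only [Pi.neg_apply, neg_smul, Finset.sum_neg_distrib]
      exact eq_neg_of_add_eq_zero_right h0
  -- By pigeonhole, some `X t` satisfies no relation of height `N`.
  obtain ⟨t, ht⟩ : ∃ t, ∀ (l : J → ℤ) (d : ℤ), (∀ j, |l j| ≤ N) → |d| ≤ N → d ≠ 0 →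
      ∑ j, l j • a' j + d • X t ≠ 0 := by
    by_contra! hcon
    choose l d hl hd hd0 h0 using hcon
    have hfin : (Set.Icc (fun _ => -(N : ℤ), -(N : ℤ)) (fun _ => (N : ℤ), (N : ℤ)) :
        Set ((J → ℤ) × ℤ)).Finite := Set.finite_Icc _ _
    have hmem (t : ℕ) : (l t, d t) ∈ Set.Icc ((fun _ => -(N : ℤ)), -(N : ℤ))
        ((fun _ : J => (N : ℤ)), (N : ℤ)) :=
      ⟨⟨fun j => (abs_le.1 (hl t j)).1, (abs_le.1 (hd t)).1⟩,
        ⟨fun j => (abs_le.1 (hl t j)).2, (abs_le.1 (hd t)).2⟩⟩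
    have hinj : Function.Injective fun t => (l t, d t) := fun s t hst => by
      obtain ⟨hls, hds⟩ := Prod.mk.inj hst
      have := (h0 s).trans (h0 t).symm
      rw [hls, hds] at this
      exact hX (zsmul_right_injective (hd0 t) (add_left_cancel this))
    exact Set.not_injOn_infinite_finite_image (s := Set.univ) Set.infinite_univ
      (hfin.subset (by rintro _ ⟨t, -, rfl⟩; exact hmem t)) hinj.injOn
  refine ⟨X t, hfrac t, fun l d hl hd => ?_⟩
  rcases eq_or_ne d 0 with rfl | hd0
  · simpa using h.rel l hl
  · exact iff_of_false (hindep l d hl hd hd0) (ht l d hl hd hd0)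

theorem Approx.exists_extend {N : ℕ} {a : J → E.G} {a' : J → E'.G}
    (h : Approx (2 * N ^ 2) a a') (x : E.G) :
    ∃ x' : E'.G, (∀ n : ℕ+, (n : ℕ) ≤ N → E.π (E.divBy x n) = E'.π (E'.divBy x' n)) ∧
      ∀ (l : J → ℤ) (d : ℤ), (∀ j, |l j| ≤ N) → |d| ≤ N →
        (∑ j, l j • a j + d • x = 0 ↔ ∑ j, l j • a' j + d • x' = 0) := by
  by_cases hx : ∃ (c : ℕ+) (m : J → ℤ), (c : ℕ) ≤ N ∧ (∀ j, |m j| ≤ N) ∧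
      (c : ℕ) • x = ∑ j, m j • a j
  · obtain ⟨c, m, hc, hm, hx⟩ := hx
    exact h.exists_extend_of_dependent x c hc m hm hx
  · push Not at hx
    exact (h.mono (by nlinarith)).exists_extend_of_independent x hx

end Approx

/-- The element of the middle group attached to an element of the universe: elements of the kernel
are sent there by `ι`, and real numbers to `0`. -/
def Carrier.toG : E.Carrier → E.G
  | ker k => E.ι k
  | grp g => g
  | fld _ => 0

/-- Two elements of the universes have the same sort, and are equal if this is the field sort. -/
inductive SameSort : E.Carrier → E'.Carrier → Prop
  | ker (k k' : ℤ) : SameSort (.ker k) (.ker k')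
  | grp (g : E.G) (g' : E'.G) : SameSort (.grp g) (.grp g')
  | fld (r : ℝ) : SameSort (.fld r) (.fld r)

/-- Tuples of elements of the universes that cannot be told apart up to height `N`. -/
structure Similar {J : Type*} [Fintype J] (N : ℕ) (w : J → E.Carrier) (w' : J → E'.Carrier) :
    Prop where
  sort : ∀ j, SameSort (w j) (w' j)
  approx : Approx N (fun j => (w j).toG) (fun j => (w' j).toG)

section Similar

variable {J : Type*} [Fintype J] {N : ℕ} {w : J → E.Carrier} {w' : J → E'.Carrier}

theorem Similar.symm (h : Similar N w w') : Similar N w' w :=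
  ⟨fun j => by
    have := h.sort j
    generalize w j = x at this ⊢
    generalize w' j = x' at this ⊢
    cases this <;> constructor, h.approx.symm⟩

theorem Similar.mono {M : ℕ} (h : Similar N w w') (hMN : M ≤ N) : Similar M w w' :=
  ⟨h.sort, h.approx.mono hMN⟩

theorem Similar.exists_extend (hN : 1 ≤ N) (h : Similar (2 * N ^ 2) w w') (c : E.Carrier) :
    ∃ c' : E'.Carrier, SameSort c c' ∧
      (∀ n : ℕ+, (n : ℕ) ≤ N → E.π (E.divBy c.toG n) = E'.π (E'.divBy c'.toG n)) ∧
      ∀ (l : J → ℤ) (d : ℤ), (∀ j, |l j| ≤ N) → |d| ≤ N →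
        (∑ j, l j • (w j).toG + d • c.toG = 0 ↔ ∑ j, l j • (w' j).toG + d • c'.toG = 0) := by
  cases c with
  | ker k =>
    obtain ⟨x', h1, h2⟩ := h.approx.exists_extend (E.ι k)
    obtain ⟨k', rfl⟩ : ∃ k', E'.ι k' = x' := (E'.exact _).1 (by
      have := h1 1 (by simpa using hN)
      rwa [divBy_one, divBy_one, π_ι, eq_comm] at this)
    exact ⟨.ker k', .ker _ _, h1, h2⟩
  | grp g =>
    obtain ⟨x', h1, h2⟩ := h.approx.exists_extend g
    exact ⟨.grp x', .grp _ _, h1, h2⟩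
  | fld r =>
    refine ⟨.fld r, .fld r, fun n _ => ?_, fun l d hl _ => ?_⟩
    · simp only [Carrier.toG, divBy_zero, map_zero]
    · simp only [Carrier.toG, smul_zero, add_zero]
      exact h.approx.rel l fun j => (hl j).trans (by exact_mod_cast (by nlinarith))

/-- Instances of addition transfer between similar tuples. -/
theorem Similar.add_eq_iff (h : Similar N w w') (hN : 3 ≤ N) (i j k : J) :
    (w i).toG + (w j).toG = (w k).toG ↔ (w' i).toG + (w' j).toG = (w' k).toG := by
  classical
  have := h.approx.rel (Pi.single i 1 + Pi.single j 1 - Pi.single k 1) fun t => by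
    have hs (s : J) : |(Pi.single s 1 : J → ℤ) t| ≤ 1 := by
      rw [Pi.single_apply]; split_ifs <;> simp
    have hN' : (3 : ℤ) ≤ N := by exact_mod_cast hN
    have h1 := abs_le.1 (hs i)
    have h2 := abs_le.1 (hs j)
    have h3 := abs_le.1 (hs k)
    rw [Pi.sub_apply, Pi.add_apply, abs_le]
    constructor <;> linarith
  simpa [sub_smul, add_smul, Finset.sum_sub_distrib, Finset.sum_add_distrib, Pi.single_apply,
    sub_eq_zero] using this

theorem Similar.eq_iff (h : Similar N w w') (hN : 3 ≤ N) (i j : J) :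
    (w i).toG = (w j).toG ↔ (w' i).toG = (w' j).toG := by
  classical
  have := h.approx.rel (Pi.single i 1 - Pi.single j 1) fun t => by
    have hs (s : J) : |(Pi.single s 1 : J → ℤ) t| ≤ 1 := by
      rw [Pi.single_apply]; split_ifs <;> simp
    have hN' : (3 : ℤ) ≤ N := by exact_mod_cast hN
    have h1 := abs_le.1 (hs i)
    have h2 := abs_le.1 (hs j)
    rw [Pi.sub_apply, abs_le]
    constructor <;> linarith
  simpa [sub_smul, Finset.sum_sub_distrib, Pi.single_apply, sub_eq_zero] using this

theorem Similar.π_eq (h : Similar N w w') (hN : 1 ≤ N) (i : J) :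
    E.π (w i).toG = E'.π (w' i).toG := by
  simpa only [divBy_one] using h.approx.frac 1 (by simpa using hN) i

theorem Similar.apply_eq_iff (h : Similar N w w') (hN : 3 ≤ N) (i j : J) :
    w i = w j ↔ w' i = w' j := by
  have key := h.eq_iff hN i j
  have hi := h.sort i
  have hj := h.sort j
  revert key
  generalize w i = x at hi ⊢
  generalize w' i = x' at hi ⊢
  generalize w j = y at hj ⊢
  generalize w' j = y' at hj ⊢
  cases hi <;> cases hj <;> simp [Carrier.toG, E.ι_injective.eq_iff, E'.ι_injective.eq_iff]

theorem SameSort.exists_ker {k : ℤ} {c : E.Carrier} {c' : E'.Carrier} (h : SameSort c c')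
    (hc : c = .ker k) : ∃ k', c' = .ker k' := by
  subst hc; cases h; exact ⟨_, rfl⟩

theorem SameSort.exists_grp {g : E.G} {c : E.Carrier} {c' : E'.Carrier} (h : SameSort c c')
    (hc : c = .grp g) : ∃ g', c' = .grp g' := by
  subst hc; cases h; exact ⟨_, rfl⟩

theorem SameSort.eq_fld {r : ℝ} {c : E.Carrier} {c' : E'.Carrier} (h : SameSort c c')
    (hc : c = .fld r) : c' = .fld r := by
  subst hc; cases h; rfl

theorem Similar.relMap (h : Similar N w w') (hN : 3 ≤ N) {n : ℕ} (R : CoverRel n)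
    (t : Fin n → J)
    (hR : Language.Structure.RelMap (L := coverLang₀) R (fun i => w (t i))) :
    Language.Structure.RelMap (L := coverLang₀) R (fun i => w' (t i)) := by
  have key (i j k : J) := h.add_eq_iff hN i j k
  have key₂ (i j : J) := h.eq_iff hN i j
  have keyπ (i : J) := h.π_eq (by omega) i
  have sort (i : J) := h.sort i
  cases R
  · rw [relMap_sortΓ] at hR ⊢
    obtain ⟨k, h0⟩ := hR
    exact (sort _).exists_ker h0
  · rw [relMap_sortG] at hR ⊢
    obtain ⟨k, h0⟩ := hR
    exact (sort _).exists_grp h0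
  · rw [relMap_sortM] at hR ⊢
    obtain ⟨k, h0⟩ := hR
    exact ⟨k, (sort _).eq_fld h0⟩
  · rw [relMap_addΓ] at hR ⊢
    obtain ⟨k, l, h0, h1, h2⟩ := hR
    obtain ⟨k', h0'⟩ := (sort _).exists_ker h0
    obtain ⟨l', h1'⟩ := (sort _).exists_ker h1
    obtain ⟨m', h2'⟩ := (sort _).exists_ker h2
    have := key (t 0) (t 1) (t 2)
    simp only [h0, h1, h2, h0', h1', h2', Carrier.toG, ← map_add, true_iff] at this
    exact ⟨k', l', h0', h1', by rw [h2', E'.ι_injective this]⟩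
  · rw [relMap_addG] at hR ⊢
    obtain ⟨k, l, h0, h1, h2⟩ := hR
    obtain ⟨k', h0'⟩ := (sort _).exists_grp h0
    obtain ⟨l', h1'⟩ := (sort _).exists_grp h1
    obtain ⟨m', h2'⟩ := (sort _).exists_grp h2
    have := key (t 0) (t 1) (t 2)
    simp only [h0, h1, h2, h0', h1', h2', Carrier.toG, true_iff] at this
    exact ⟨k', l', h0', h1', by rw [h2', this]⟩
  · rw [relMap_addM] at hR ⊢
    obtain ⟨k, l, h0, h1, h2⟩ := hR
    exact ⟨k, l, (sort _).eq_fld h0, (sort _).eq_fld h1, (sort _).eq_fld h2⟩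
  · rw [relMap_mulM] at hR ⊢
    obtain ⟨k, l, h0, h1, h2⟩ := hR
    exact ⟨k, l, (sort _).eq_fld h0, (sort _).eq_fld h1, (sort _).eq_fld h2⟩
  · rw [relMap_iota] at hR ⊢
    obtain ⟨k, h0, h1⟩ := hR
    obtain ⟨k', h0'⟩ := (sort _).exists_ker h0
    obtain ⟨g', h1'⟩ := (sort _).exists_grp h1
    have := key₂ (t 0) (t 1)
    simp only [h0, h1, h0', h1', Carrier.toG, true_iff] at this
    exact ⟨k', h0', by rw [h1', this]⟩
  · rw [relMap_proj] at hR ⊢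
    obtain ⟨g, r, hr, hrg, h0, h1⟩ := hR
    obtain ⟨g', h0'⟩ := (sort _).exists_grp h0
    have := keyπ (t 0)
    simp only [h0, h0', Carrier.toG] at this
    exact ⟨g', r, hr, hrg.trans this, h0', (sort _).eq_fld h1⟩

end Similar

theorem exists_var_eq {α : Type*} (t : coverLang₀.Term α) : ∃ i, t = .var i := by
  cases t with
  | var i => exact ⟨i, rfl⟩
  | func f _ => exact nomatch f

section Formula

variable {n : ℕ}

/-- One step of the Ehrenfeucht–Fraïssé game: a move in the first structure is answered in the
second. -/
theorem Similar.exists_snoc {N : ℕ} (hN : 1 ≤ N) {v : Unit → E.Carrier} {v' : Unit → E'.Carrier}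
    {w : Fin n → E.Carrier} {w' : Fin n → E'.Carrier}
    (h : Similar (2 * N ^ 2) (Sum.elim v w) (Sum.elim v' w')) (c : E.Carrier) :
    ∃ c', Similar N (Sum.elim v (Fin.snoc w c : Fin (n + 1) → E.Carrier))
      (Sum.elim v' (Fin.snoc w' c' : Fin (n + 1) → E'.Carrier)) := by
  obtain ⟨c', hc, hfrac, hrel⟩ := h.exists_extend hN c
  have h' := h.mono (show N ≤ 2 * N ^ 2 by nlinarith)
  refine ⟨c', ?_, ?_, ?_⟩
  · rintro (i | i)
    · exact h.sort (Sum.inl i)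
    · refine Fin.lastCases ?_ (fun i => ?_) i
      · simpa using hc
      · simpa using h.sort (Sum.inr i)
  · rintro k hk (i | i)
    · exact h'.approx.frac k hk (Sum.inl i)
    · refine Fin.lastCases ?_ (fun i => ?_) i
      · simpa using hfrac k hk
      · simpa using h'.approx.frac k hk (Sum.inr i)
  · intro m hm
    have := hrel (Sum.elim (fun i => m (.inl i)) fun i => m (.inr i.castSucc))
      (m (.inr (Fin.last n))) (by rintro (i | i) <;> exact hm _) (hm _)
    simpa only [Fintype.sum_sum_type, Sum.elim_inl, Sum.elim_inr, Fin.sum_univ_castSucc,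
      Fin.snoc_castSucc, Fin.snoc_last, add_assoc] using this

/-- Each formula cannot tell apart tuples that are similar up to a height depending only on the
formula. -/
theorem exists_realize_iff (E : CircleExtension.{u}) (E' : CircleExtension.{v})
    (φ : coverLang₀.BoundedFormula Unit n) :
    ∃ N : ℕ, ∀ (v : Unit → E.Carrier) (v' : Unit → E'.Carrier) (w : Fin n → E.Carrier)
      (w' : Fin n → E'.Carrier), Similar N (Sum.elim v w) (Sum.elim v' w') →
      (φ.Realize v w ↔ φ.Realize v' w') := by
  induction φ with
  | falsum => exact ⟨0, fun _ _ _ _ _ => Iff.rfl⟩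
  | equal t₁ t₂ =>
    obtain ⟨i, rfl⟩ := exists_var_eq t₁
    obtain ⟨j, rfl⟩ := exists_var_eq t₂
    exact ⟨3, fun _ _ _ _ h => h.apply_eq_iff le_rfl i j⟩
  | rel R ts =>
    choose t ht using fun i => exists_var_eq (ts i)
    obtain rfl : ts = fun i => .var (t i) := funext ht
    exact ⟨3, fun _ _ _ _ h => ⟨h.relMap le_rfl R t, h.symm.relMap le_rfl R t⟩⟩
  | imp φ ψ hφ hψ =>
    obtain ⟨M, hM⟩ := hφ
    obtain ⟨N, hN⟩ := hψ
    exact ⟨max M N, fun v v' w w' h => imp_congr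
      (hM _ _ _ _ (h.mono (le_max_left _ _))) (hN _ _ _ _ (h.mono (le_max_right _ _)))⟩
  | all φ hφ =>
    obtain ⟨M, hM⟩ := hφ
    refine ⟨2 * (M + 1) ^ 2, fun v v' w w' h => ⟨fun H c' => ?_, fun H c => ?_⟩⟩
    · obtain ⟨c, hc⟩ := h.symm.exists_snoc (by omega) c'
      exact (hM _ _ _ _ (hc.symm.mono (by omega))).1 (H c)
    · obtain ⟨c', hc⟩ := h.exists_snoc (by omega) c
      exact (hM _ _ _ _ (hc.mono (by omega))).2 (H c')

end Formula

theorem elemEquiv_iff_forall_formula : E.ElemEquiv E' ↔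
    ∀ φ : coverLang₀.Formula Unit,
      φ.Realize (fun _ => (.ker 1 : E.Carrier)) ↔ φ.Realize (fun _ => (.ker 1 : E'.Carrier)) := by
  rw [ElemEquiv, Language.elementarilyEquivalent_iff,
    ← (Language.Formula.equivSentence (L := coverLang₀) (α := Unit)).forall_congr_right]
  refine forall_congr' fun φ => iff_congr ?_ ?_
  · exact Language.Formula.realize_equivSentence _ φ
  · exact Language.Formula.realize_equivSentence _ φ

/-- If the fractions of the two generators lie over the same points of the circle, then the
generators are similar up to every height. -/
theorem elemEquiv_of_forall_π_divBy
    (h : ∀ n : ℕ+, E.π (E.divBy (E.ι 1) n) = E'.π (E'.divBy (E'.ι 1) n)) : E.ElemEquiv E' := by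
  refine elemEquiv_iff_forall_formula.2 fun φ => ?_
  obtain ⟨N, hN⟩ := exists_realize_iff E E' φ
  refine hN _ _ _ _ ⟨?_, ?_, ?_⟩
  · rintro (i | i)
    · exact .ker _ _
    · exact i.elim0
  · rintro n - (i | i)
    · exact h n
    · exact i.elim0
  · intro m _
    simp [Carrier.toG, ← map_zsmul, map_eq_zero_iff _ E.ι_injective,
      map_eq_zero_iff _ E'.ι_injective]

/-! ### The formula describing the fractions of the generator -/

/-- The formula, in one variable `c` of the kernel sort, saying that there are `y` in the group and
`r` in the field such that `(k + 2) y = ι c`, `π y = r` and `(k + 2) r = 1`. The multiples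
`(j + 1) y` and `(j + 1) r` with `j ≤ k + 1` are quantified too, and `1` is characterized as an
idempotent `s` with `s + s ≠ s`. -/
noncomputable def fractionFormula (k : ℕ) : coverLang₀.Formula Unit :=
  let c : coverLang₀.Term (Unit ⊕ (Fin (k + 2) ⊕ Fin (k + 2))) := .var (.inl ())
  let y (j : Fin (k + 2)) : coverLang₀.Term (Unit ⊕ (Fin (k + 2) ⊕ Fin (k + 2))) :=
    .var (.inr (.inl j))
  let r (j : Fin (k + 2)) : coverLang₀.Term (Unit ⊕ (Fin (k + 2) ⊕ Fin (k + 2))) :=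
    .var (.inr (.inr j))
  Language.Formula.iExs (Fin (k + 2) ⊕ Fin (k + 2)) <|
    Language.Formula.iInf (fun j : Fin (k + 1) =>
      Language.Relations.formula (L := coverLang₀) CoverRel.addG ![y j.castSucc, y 0, y j.succ]) ⊓
    Language.Formula.iInf (fun j : Fin (k + 1) =>
      Language.Relations.formula (L := coverLang₀) CoverRel.addM ![r j.castSucc, r 0, r j.succ]) ⊓
    Language.Relations.formula (L := coverLang₀) CoverRel.iota ![c, y (Fin.last _)] ⊓
    Language.Relations.formula (L := coverLang₀) CoverRel.proj ![y 0, r 0] ⊓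
    Language.Relations.formula (L := coverLang₀) CoverRel.mulM
      ![r (Fin.last _), r (Fin.last _), r (Fin.last _)] ⊓
    (Language.Relations.formula (L := coverLang₀) CoverRel.addM
      ![r (Fin.last _), r (Fin.last _), r (Fin.last _)]).not

theorem realize_fractionFormula (k : ℕ) :
    (fractionFormula k).Realize (fun _ => (.ker 1 : E.Carrier)) ↔
      ∃ y r : Fin (k + 2) → E.Carrier,
        (∀ j : Fin (k + 1), ∃ a b, y j.castSucc = .grp a ∧ y 0 = .grp b ∧ y j.succ = .grp (a + b)) ∧
        (∀ j : Fin (k + 1), ∃ a b, r j.castSucc = .fld a ∧ r 0 = .fld b ∧ r j.succ = .fld (a + b)) ∧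
        (∃ l, (.ker 1 : E.Carrier) = .ker l ∧ y (Fin.last _) = .grp (E.ι l)) ∧
        (∃ (g : E.G) (s : ℝ), s ∈ Set.Ico (0 : ℝ) 1 ∧ (s : UnitAddCircle) = E.π g ∧
          y 0 = .grp g ∧ r 0 = .fld s) ∧
        (∃ a b, r (Fin.last _) = .fld a ∧ r (Fin.last _) = .fld b ∧
          r (Fin.last _) = .fld (a * b)) ∧
        ¬ ∃ a b, r (Fin.last _) = .fld a ∧ r (Fin.last _) = .fld b ∧
          r (Fin.last _) = .fld (a + b) := by
  refine Language.Formula.realize_iExs.trans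
    ((Equiv.sumArrowEquivProdArrow (Fin (k + 2)) (Fin (k + 2)) E.Carrier).exists_congr_left.trans
      (Prod.exists.trans (exists_congr fun y => exists_congr fun r => ?_)))
  simp only [Language.Formula.realize_inf, Language.Formula.realize_iInf,
    Language.Formula.realize_not, and_assoc]
  exact and_congr (forall_congr' fun j => Language.Formula.realize_rel.trans relMap_addG) <|
    and_congr (forall_congr' fun j => Language.Formula.realize_rel.trans relMap_addM) <|
    and_congr (Language.Formula.realize_rel.trans relMap_iota) <|
    and_congr (Language.Formula.realize_rel.trans relMap_proj) <|
    and_congr (Language.Formula.realize_rel.trans relMap_mulM) <|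
    not_congr (Language.Formula.realize_rel.trans relMap_addM)

theorem π_divBy_of_realize_fractionFormula {k : ℕ} {n : ℕ+} (hn : (n : ℕ) = k + 2)
    (h : (fractionFormula k).Realize (fun _ => (.ker 1 : E.Carrier))) :
    E.π (E.divBy (E.ι 1) n) = ((1 / (n : ℕ) : ℝ) : UnitAddCircle) := by
  obtain ⟨y, r, hy, hr, ⟨l, hl, hyl⟩, ⟨g, s, -, hs, hy0, hr0⟩, ⟨a, b, ha, hb, hab⟩, hne⟩ :=
    realize_fractionFormula k |>.1 h
  injection hl with hl
  subst hl
  have hyj (j : Fin (k + 2)) : y j = .grp (((j : ℕ) + 1) • g) := by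
    induction j using Fin.induction with
    | zero => simpa using hy0
    | succ j ih =>
      obtain ⟨a, b, h0, h1, h2⟩ := hy j
      rw [ih] at h0
      rw [hy0] at h1
      injection h0 with h0; injection h1 with h1
      rw [h2, ← h0, ← h1, Fin.val_castSucc, Fin.val_succ, succ_nsmul _ (j + 1 : ℕ)]
  have hrj (j : Fin (k + 2)) : r j = .fld (((j : ℕ) + 1) * s) := by
    induction j using Fin.induction with
    | zero => simpa using hr0
    | succ j ih =>
      obtain ⟨a, b, h0, h1, h2⟩ := hr j
      rw [ih] at h0
      rw [hr0] at h1
      injection h0 with h0; injection h1 with h1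
      rw [h2, ← h0, ← h1, Fin.val_castSucc, Fin.val_succ]
      push_cast
      congr 1
      ring
  rw [hyj, Fin.val_last] at hyl
  injection hyl with hyl
  have hg : g = E.divBy (E.ι 1) n := E.divBy_unique _ _ _ (by rw [← hyl, hn])
  rw [hrj, Fin.val_last] at ha hb hab
  injection ha with ha; injection hb with hb; injection hab with hab
  rw [← ha, ← hb] at hab
  have h0 : (((k + 1 : ℕ) : ℝ) + 1) * s ≠ 0 := fun h0 => hne ⟨0, 0, by
    rw [hrj, Fin.val_last, h0, add_zero]; simp⟩
  have h1 := (mul_eq_left₀ h0).1 hab.symm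
  rw [← hg, ← hs, hn]
  congr 1
  push_cast at h1 ⊢
  rw [eq_div_iff (by positivity)]
  linarith

theorem standard_π (x : ℝ) : standard.π x = (x : UnitAddCircle) := rfl

theorem standard_ι (k : ℤ) : standard.ι k = (k : ℝ) := rfl

theorem standard_divBy (x : ℝ) (n : ℕ+) : standard.divBy x n = (x / (n : ℕ) : ℝ) := by
  refine (standard.divBy_unique x (x / (n : ℕ) : ℝ) n ?_).symm
  have : ((n : ℕ) : ℝ) ≠ 0 := by exact_mod_cast n.ne_zero
  exact (nsmul_eq_mul (α := ℝ) _ _).trans (mul_div_cancel₀ x this)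

theorem standard_π_divBy_ι_one (n : ℕ+) :
    standard.π (standard.divBy (standard.ι 1) n) = ((1 / (n : ℕ) : ℝ) : UnitAddCircle) := by
  rw [standard_ι, standard_divBy, standard_π, Int.cast_one]

theorem standard_realize_fractionFormula (k : ℕ) :
    (fractionFormula k).Realize (fun _ => (.ker 1 : standard.Carrier)) := by
  have hk : (k : ℝ) + 2 ≠ 0 := by positivity
  refine (realize_fractionFormula k).2
    ⟨fun j => .grp ((((j : ℕ) + 1) / (k + 2) : ℝ)), fun j => .fld (((j : ℕ) + 1) / (k + 2)),
      fun j => ⟨_, _, rfl, rfl, ?_⟩, fun j => ⟨_, _, rfl, rfl, ?_⟩, ⟨1, rfl, ?_⟩,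
      ⟨_, _, ?_, ?_, rfl, rfl⟩, ⟨1, 1, ?_, ?_, ?_⟩, ?_⟩
  · refine congrArg Carrier.grp (?_ : (_ : ℝ) = _ + _)
    simp only [Fin.val_succ, Fin.val_castSucc, Fin.val_zero]
    push_cast
    ring
  · simp only [Fin.val_succ, Fin.val_castSucc, Fin.val_zero]
    push_cast
    congr 1
    ring
  · refine congrArg Carrier.grp (?_ : (_ : ℝ) = ((1 : ℤ) : ℝ))
    rw [Fin.val_last]
    push_cast
    field_simp
    ring
  · simp only [Fin.val_zero, Nat.cast_zero, zero_add, Set.mem_Ico]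
    refine ⟨by positivity, ?_⟩
    rw [div_lt_one (by positivity)]
    have : (0 : ℝ) ≤ k := by positivity
    linarith
  · rfl
  · simp only [Fin.val_last]; push_cast; congr 1; field_simp; ring
  · simp only [Fin.val_last]; push_cast; congr 1; field_simp; ring
  · simp only [Fin.val_last]; push_cast; congr 1; field_simp; ring
  · rintro ⟨a, b, ha, hb, hab⟩
    injection ha with ha; injection hb with hb; injection hab with hab
    rw [← ha, ← hb, left_eq_add, Fin.val_last] at hab
    have : (((k + 1 : ℕ) : ℝ) + 1) / (k + 2) ≠ 0 := by positivity
    exact this hab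

theorem elemEquiv_standard_iff : E.ElemEquiv standard ↔
    ∀ n : ℕ+, E.π (E.divBy (E.ι 1) n) = ((1 / (n : ℕ) : ℝ) : UnitAddCircle) := by
  refine ⟨fun h n => ?_, fun h =>
    elemEquiv_of_forall_π_divBy fun n => (h n).trans (standard_π_divBy_ι_one n).symm⟩
  rcases eq_or_ne n 1 with rfl | hn
  · rw [divBy_one, π_ι, PNat.one_coe, Nat.cast_one, div_one]
    exact (AddCircle.coe_period (1 : ℝ)).symm
  · obtain ⟨k, hk⟩ : ∃ k, (n : ℕ) = k + 2 := by
      have h1 : (n : ℕ) ≠ 1 := fun h => hn (PNat.eq h)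
      have := n.pos
      exact ⟨n - 2, by omega⟩
    exact π_divBy_of_realize_fractionFormula hk
      ((elemEquiv_iff_forall_formula.1 h _).2 (standard_realize_fractionFormula k))

/-! ### Covering maps onto the circle -/

/-- The covering `ℝ → ℝ/ℤ` lifts to a homomorphism into any topological group covering the
circle. -/
theorem exists_lift_of_isCoveringMap [TopologicalSpace E.G] [IsTopologicalAddGroup E.G]
    (hE : IsCoveringMap E.π) : ∃ f : ℝ →+ E.G, ∀ x, E.π (f x) = (x : UnitAddCircle) := by
  obtain ⟨F, ⟨hF0, hF⟩, -⟩ := hE.existsUnique_continuousMap_lifts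
    (⟨fun x : ℝ => (x : UnitAddCircle), AddCircle.continuous_mk' 1⟩ : C(ℝ, UnitAddCircle)) 0 0
    (map_zero E.π)
  replace hF (x : ℝ) : E.π (F x) = (x : UnitAddCircle) := congrFun hF x
  refine ⟨AddMonoidHom.mk' F fun x y => ?_, hF⟩
  -- Both sides lift `y ↦ x + y` and agree at `0`.
  refine congrFun (hE.eq_of_comp_eq (g₁ := fun y => F (x + y)) (g₂ := fun y => F x + F y)
    (by fun_prop) (by fun_prop) ?_ 0 ?_) y
  · ext y
    simp [hF]
  · simp [hF0]

/-- A homomorphism `ℝ → G` over the circle is automatically bijective. If `k ≠ 0` is in its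
kernel, then so is `1/2` because `G` is torsion-free, but `1/2` is not an integer. It maps `1` to
`m` times the generator of the kernel, and dividing by `m` shows that `1/m` is an integer. -/
theorem bijective_of_lift (f : ℝ →+ E.G) (hf : ∀ x, E.π (f x) = (x : UnitAddCircle)) :
    Function.Bijective f := by
  have hdiv (x : ℝ) (m : ℤ) (hm : m ≠ 0) : m • f (x / m) = f x := by
    rw [← map_zsmul, zsmul_eq_mul]
    have : (m : ℝ) ≠ 0 := by exact_mod_cast hm
    congr 1
    field_simp
  have hint (x : ℝ) (hx : E.π (f x) = 0) : ∃ k : ℤ, (k : ℝ) = x := by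
    rw [hf] at hx
    obtain ⟨k, hk⟩ := (AddCircle.coe_eq_zero_iff 1).1 hx
    exact ⟨k, by simpa using hk⟩
  have hinj : ∀ x, f x = 0 → x = 0 := by
    intro x hx
    by_contra hx0
    obtain ⟨k, rfl⟩ := hint x (by rw [hx, map_zero])
    have hk : k ≠ 0 := by rintro rfl; simp at hx0
    have h2 := hdiv k (2 * k) (by omega)
    rw [hx] at h2
    have h3 : f ((k : ℝ) / ((2 * k : ℤ) : ℝ)) = 0 :=
      zsmul_right_injective (show 2 * k ≠ 0 by omega) (h2.trans (smul_zero _).symm)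
    obtain ⟨l, hl⟩ := hint _ (by rw [h3, map_zero])
    have hk' : (k : ℝ) ≠ 0 := by exact_mod_cast hk
    have h4 : (k : ℝ) / ((2 * k : ℤ) : ℝ) = 1 / 2 := by push_cast; field_simp
    have h5 : (l : ℝ) * 2 = 1 := by rw [hl, h4]; norm_num
    have : l * 2 = 1 := by exact_mod_cast h5
    omega
  refine ⟨(injective_iff_map_eq_zero f).2 hinj, fun g => ?_⟩
  obtain ⟨m, hm⟩ := (E.exact (f 1)).1 (by rw [hf]; exact AddCircle.coe_period 1)
  have hm0 : m ≠ 0 := by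
    rintro rfl
    rw [map_zero] at hm
    exact one_ne_zero (hinj 1 hm.symm)
  have hι : f (1 / m) = E.ι 1 := by
    refine zsmul_right_injective hm0 ((hdiv 1 m hm0).trans ?_)
    simp [← hm, ← map_zsmul]
  obtain ⟨r, hr⟩ := QuotientAddGroup.mk_surjective (E.π g)
  obtain ⟨k, hk⟩ := (E.exact (g - f r)).1 (by rw [map_sub, hf, ← hr]; exact sub_self _)
  refine ⟨k • (1 / (m : ℝ)) + r, ?_⟩
  rw [map_add, map_zsmul, hι, ← map_zsmul, smul_eq_mul, mul_one, hk, sub_add_cancel]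

theorem iso₀_standard_iff : E.Iso₀ standard ↔
    ∃ _ : TopologicalSpace E.G, IsTopologicalAddGroup E.G ∧ IsCoveringMap E.π := by
  rw [iso₀_iff]
  constructor
  · rintro ⟨f, hf⟩
    let f' : E.G ≃+ ℝ := f
    let _ : TopologicalSpace E.G := TopologicalSpace.induced f' inferInstance
    refine ⟨inferInstance, topologicalAddGroup_induced f', ?_⟩
    let h : E.G ≃ₜ ℝ := f'.toEquiv.toHomeomorphOfIsInducing ⟨rfl⟩
    have : (E.π : E.G → UnitAddCircle) = ((↑) : ℝ → UnitAddCircle) ∘ h :=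
      funext fun x => (hf x).symm
    rw [this]
    exact (AddCircle.isCoveringMap_coe (1 : ℝ)).comp_homeomorph h
  · rintro ⟨_, _, hE⟩
    obtain ⟨f, hf⟩ := exists_lift_of_isCoveringMap hE
    let e : ℝ ≃+ E.G := AddEquiv.ofBijective f (bijective_of_lift f hf)
    exact ⟨e.symm, fun x => (hf _).symm.trans (congrArg E.π (e.apply_symm_apply x))⟩

theorem iso_standard_iff : E.Iso standard ↔
    (∃ _ : TopologicalSpace E.G, IsTopologicalAddGroup E.G ∧ IsCoveringMap E.π) ∧
      ∀ n : ℕ+, E.π (E.divBy (E.ι 1) n) = ((1 / (n : ℕ) : ℝ) : UnitAddCircle) := by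
  rw [iso_iff_range_piHat, ← iso₀_iff_range_piHat, iso₀_standard_iff]
  refine and_congr_right fun _ => ?_
  rw [Subtype.ext_iff, funext_iff]
  exact forall_congr' fun n => by rw [piHat_apply, piHat_apply, standard_π_divBy_ι_one]

/-! ### Twists of the standard extension -/

theorem exists_rat_of_coe_eq_coe {x : ℝ} {q : ℚ} (h : (x : UnitAddCircle) = ((q : ℝ) : UnitAddCircle)) :
    ∃ r : ℚ, (r : ℝ) = x := by
  rw [← sub_eq_zero, ← AddCircle.coe_sub, AddCircle.coe_eq_zero_iff] at h
  obtain ⟨k, hk⟩ := h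
  refine ⟨k + q, ?_⟩
  rw [zsmul_eq_mul, mul_one] at hk
  push_cast
  linarith

/-- The extension with the same group `ℝ` and kernel `ℤ` as the standard one, and with projection
`x ↦ x + ψ x`, where `ψ` is a homomorphism to the torsion of the circle that vanishes on `ℚ`. The
group is lifted to an arbitrary universe. -/
noncomputable def twist (ψ : ℝ →+ UnitAddCircle) (hψ : ∀ q : ℚ, ψ q = 0)
    (htor : ∀ x, ∃ q : ℚ, ψ x = ((q : ℝ) : UnitAddCircle)) : CircleExtension.{u} where
  G := ULift.{u} ℝ
  ι := (AddEquiv.ulift.symm : ℝ ≃+ ULift.{u} ℝ).toAddMonoidHom.comp (Int.castAddHom ℝ)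
  π := (QuotientAddGroup.mk' (AddSubgroup.zmultiples (1 : ℝ)) + ψ).comp
    (AddEquiv.ulift : ULift.{u} ℝ ≃+ ℝ).toAddMonoidHom
  ι_injective := fun a b h => Int.cast_injective (α := ℝ) (congrArg ULift.down h)
  exact := by
    rintro ⟨x⟩
    change (x : UnitAddCircle) + ψ x = 0 ↔ ∃ k : ℤ, ULift.up (k : ℝ) = ULift.up x
    constructor
    · intro h
      obtain ⟨q, hq⟩ := htor x
      obtain ⟨r, rfl⟩ : ∃ r : ℚ, (r : ℝ) = x := exists_rat_of_coe_eq_coe (q := -q) (by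
        rw [eq_neg_of_add_eq_zero_left h, hq, Rat.cast_neg, AddCircle.coe_neg])
      rw [hψ, add_zero, AddCircle.coe_eq_zero_iff] at h
      obtain ⟨k, hk⟩ := h
      exact ⟨k, by rw [← hk, zsmul_eq_mul, mul_one]⟩
    · rintro ⟨k, hk⟩
      obtain rfl : (k : ℝ) = x := congrArg ULift.down hk
      rw [show ψ (k : ℝ) = 0 by simpa using hψ k, add_zero]
      exact (AddCircle.coe_eq_zero_iff 1).2 ⟨k, by simp⟩
  π_surjective := by
    intro c
    obtain ⟨x, rfl⟩ := QuotientAddGroup.mk_surjective c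
    obtain ⟨q, hq⟩ := htor x
    refine ⟨⟨x - q⟩, ?_⟩
    change ((x - q : ℝ) : UnitAddCircle) + ψ (x - q) = (x : UnitAddCircle)
    rw [map_sub, hψ, sub_zero, hq, AddCircle.coe_sub, sub_add_cancel]
  divisible := fun n x => ⟨⟨x.down / (n : ℕ)⟩, by
    have : ((n : ℕ) : ℝ) ≠ 0 := by exact_mod_cast n.ne_zero
    ext
    rw [ULift.smul_down, nsmul_eq_mul]
    field_simp⟩
  torsionFree := (AddEquiv.ulift : ULift.{u} ℝ ≃+ ℝ).injective.isAddTorsionFree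
    (AddEquiv.ulift : ULift.{u} ℝ ≃+ ℝ).toAddMonoidHom

section twist

variable {ψ : ℝ →+ UnitAddCircle} {hψ : ∀ q : ℚ, ψ q = 0}
  {htor : ∀ x, ∃ q : ℚ, ψ x = ((q : ℝ) : UnitAddCircle)} {ψ' : ℝ →+ UnitAddCircle}
  {hψ' : ∀ q : ℚ, ψ' q = 0} {htor' : ∀ x, ∃ q : ℚ, ψ' x = ((q : ℝ) : UnitAddCircle)}

theorem twist_elemEquiv_standard : (twist.{u} ψ hψ htor).ElemEquiv standard := by
  refine elemEquiv_standard_iff.2 fun n => ?_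
  have h : (twist.{u} ψ hψ htor).divBy ((twist.{u} ψ hψ htor).ι 1) n =
      ULift.up (1 / (n : ℕ) : ℝ) := by
    refine ((twist.{u} ψ hψ htor).divBy_unique _ (ULift.up (1 / (n : ℕ) : ℝ) : ULift.{u} ℝ) n ?_).symm
    refine congrArg ULift.up (?_ : (n : ℕ) • (1 / (n : ℕ) : ℝ) = ((1 : ℤ) : ℝ))
    have : ((n : ℕ) : ℝ) ≠ 0 := by exact_mod_cast n.ne_zero
    rw [nsmul_eq_mul, Int.cast_one]
    field_simp
  rw [h]
  change ((1 / (n : ℕ) : ℝ) : UnitAddCircle) + ψ (1 / (n : ℕ) : ℝ) = _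
  rw [show ψ (1 / (n : ℕ) : ℝ) = 0 by simpa using hψ (1 / (n : ℕ)), add_zero]

/-- An isomorphism of twists moves each `x` by a rational number `q`, and then moves `x / n` by
`q / n`. -/
theorem exists_rat_of_iso₀_twist (h : (twist.{u} ψ hψ htor).Iso₀ (twist.{v} ψ' hψ' htor')) (x : ℝ) :
    ∃ q : ℚ, ∀ n : ℕ, n ≠ 0 → ψ (x / n) - ψ' (x / n) = ((q / n : ℝ) : UnitAddCircle) := by
  obtain ⟨f, hf⟩ := iso₀_iff.1 h
  let f' : ULift.{u} ℝ ≃+ ULift.{v} ℝ := f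
  let g : ℝ ≃+ ℝ := ((AddEquiv.ulift : ULift.{u} ℝ ≃+ ℝ).symm.trans f').trans AddEquiv.ulift
  have hg (y : ℝ) : (g y : UnitAddCircle) + ψ' (g y) = y + ψ y := hf (ULift.up y)
  obtain ⟨p, hp⟩ := htor x
  obtain ⟨p', hp'⟩ := htor' (g x)
  obtain ⟨q, hq⟩ : ∃ q : ℚ, (q : ℝ) = g x - x := exists_rat_of_coe_eq_coe (q := p - p') (by
    have := hg x
    rw [hp, hp'] at this
    push_cast
    rw [AddCircle.coe_sub, AddCircle.coe_sub, sub_eq_sub_iff_add_eq_add, this, add_comm])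
  refine ⟨q, fun n hn => ?_⟩
  have hn' : (n : ℝ) ≠ 0 := by exact_mod_cast hn
  have hgn : g (x / n) = x / n + q / n := by
    have : n • g (x / n) = g x := by
      rw [← map_nsmul, nsmul_eq_mul, mul_div_cancel₀ _ hn']
    rw [nsmul_eq_mul] at this
    field_simp
    linarith
  have := hg (x / n)
  have hqn : ψ' ((q : ℝ) / n) = 0 := by simpa using hψ' (q / n)
  rw [hgn, map_add, hqn, add_zero, AddCircle.coe_add, add_assoc, add_right_inj] at this
  rw [← this, add_sub_cancel_right]

end twist

/-! ### Many pairwise non-isomorphic twists -/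

/-- The inclusion `ℚ/ℤ → ℝ/ℤ`. -/
noncomputable def ratCircleHom : AddCircle (1 : ℚ) →+ UnitAddCircle :=
  QuotientAddGroup.map _ _ (Rat.castHom ℝ : ℚ →+ ℝ) (by
    rw [AddSubgroup.zmultiples_le]
    exact ⟨1, by simp⟩)

theorem ratCircleHom_coe (q : ℚ) : ratCircleHom (q : AddCircle (1 : ℚ)) = ((q : ℝ) : UnitAddCircle) :=
  rfl

theorem ratCircleHom_injective : Function.Injective ratCircleHom := by
  refine (injective_iff_map_eq_zero _).2 fun c hc => ?_
  obtain ⟨q, rfl⟩ := QuotientAddGroup.mk_surjective c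
  obtain ⟨k, hk⟩ := (AddCircle.coe_eq_zero_iff 1).1 hc
  refine (AddCircle.coe_eq_zero_iff 1).2 ⟨k, ?_⟩
  rw [zsmul_eq_mul, mul_one] at hk ⊢
  have hk' : (k : ℝ) = (q : ℝ) := hk
  exact_mod_cast hk'

/-- The rational numbers whose denominator is a power of `3`. -/
def triadic : AddSubgroup ℚ where
  carrier := {q | ∃ (k : ℕ) (m : ℤ), q * 3 ^ k = m}
  zero_mem' := ⟨0, 0, by simp⟩
  add_mem' := by
    rintro a b ⟨k, m, h⟩ ⟨l, n, h'⟩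
    exact ⟨k + l, m * 3 ^ l + n * 3 ^ k, by push_cast; rw [← h, ← h']; ring⟩
  neg_mem' := by
    rintro a ⟨k, m, h⟩
    exact ⟨k, -m, by push_cast; rw [← h]; ring⟩

/-- A homomorphism from `ℚ` to the torsion of the circle that is not a multiple of `q ↦ q mod ℤ`,
as it vanishes on the fractions `1 / 3 ^ k` but not on `1 / 2`. -/
theorem exists_triadic_character : ∃ χ : ℚ →+ UnitAddCircle,
    (∀ q, ∃ p : ℚ, χ q = ((p : ℝ) : UnitAddCircle)) ∧ (∀ k : ℕ, χ (1 / 3 ^ k) = 0) ∧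
      χ (1 / 2) ≠ 0 := by
  have h2 : ((1 / 2 : ℚ) : ℚ ⧸ triadic) ≠ 0 := by
    rw [Ne, QuotientAddGroup.eq_zero_iff]
    rintro ⟨k, m, h⟩
    have h' : (3 : ℚ) ^ k = 2 * m := by rw [← h]; ring
    have h'' : (3 : ℤ) ^ k = 2 * m := by exact_mod_cast h'
    have hodd : Odd ((3 : ℤ) ^ k) := Odd.pow (by decide)
    exact (Int.not_even_iff_odd.2 hodd) ⟨m, by rw [h'']; ring⟩
  obtain ⟨c, hc⟩ := CharacterModule.exists_character_apply_ne_zero_of_ne_zero h2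
  let c' : (ℚ ⧸ triadic) →+ AddCircle (1 : ℚ) := c
  refine ⟨(ratCircleHom.comp c').comp (QuotientAddGroup.mk' triadic), fun q => ?_, fun k => ?_, ?_⟩
  · obtain ⟨p, hp⟩ := QuotientAddGroup.mk_surjective (c' (q : ℚ ⧸ triadic))
    exact ⟨p, (congrArg ratCircleHom hp.symm).trans (ratCircleHom_coe p)⟩
  · have : ((1 / 3 ^ k : ℚ) : ℚ ⧸ triadic) = 0 :=
      (QuotientAddGroup.eq_zero_iff _).2 ⟨k, 1, by field_simp; simp⟩
    simp only [AddMonoidHom.comp_apply, QuotientAddGroup.mk'_apply, this, map_zero]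
  · intro h
    exact hc ((map_eq_zero_iff _ ratCircleHom_injective).1 h)

theorem not_forall_triadic_character_eq {χ : ℚ →+ UnitAddCircle} (h3 : ∀ k : ℕ, χ (1 / 3 ^ k) = 0)
    (h2 : χ (1 / 2) ≠ 0) (q : ℚ) :
    ¬ ∀ n : ℕ, n ≠ 0 → χ (1 / n) = ((q / n : ℝ) : UnitAddCircle) := by
  intro h
  have hdvd (k : ℕ) : ∃ m : ℤ, q = m * 3 ^ k := by
    have := h (3 ^ k) (by positivity)
    push_cast at this
    rw [h3, eq_comm, AddCircle.coe_eq_zero_iff] at this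
    obtain ⟨m, hm⟩ := this
    rw [zsmul_eq_mul, mul_one, eq_div_iff (by positivity)] at hm
    exact ⟨m, by exact_mod_cast hm.symm⟩
  obtain ⟨m, hm⟩ := hdvd 0
  rw [pow_zero, mul_one] at hm
  obtain ⟨l, hl⟩ := hdvd m.natAbs
  rw [hm] at hl
  have hl' : m = l * 3 ^ m.natAbs := by exact_mod_cast hl
  have hm0 : m = 0 := by
    refine Int.eq_zero_of_abs_lt_dvd (Dvd.intro_left l hl'.symm) ?_
    rw [← Int.natCast_natAbs]
    exact_mod_cast Nat.lt_pow_self (by norm_num)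
  apply h2
  have := h 2 (by norm_num)
  rw [hm, hm0] at this
  simpa using this

/-- A family of twists indexed by the subsets of a basis of `ℝ` modulo `ℚ` over `ℚ`. -/
theorem exists_many_twists : ∃ S : Set CircleExtension.{u},
    (2 : Cardinal) ^ Cardinal.aleph0 ≤ Cardinal.mk S ∧
      (∀ E ∈ S, E.ElemEquiv standard) ∧ S.Pairwise fun E E' => ¬ E.Iso₀ E' := by
  classical
  obtain ⟨χ, htor, h3, h2⟩ := exists_triadic_character
  let R : Submodule ℚ ℝ := Submodule.span ℚ {1}
  let b := Module.Basis.ofVectorSpace ℚ (ℝ ⧸ R)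
  let I := Module.Basis.ofVectorSpaceIndex ℚ (ℝ ⧸ R)
  have hI : Infinite I := by
    by_contra hfin
    rw [not_infinite_iff_finite] at hfin
    have : Module.Finite ℚ (ℝ ⧸ R) := Module.Finite.of_basis b
    have : Module.Finite ℚ ℝ := Module.Finite.of_submodule_quotient R
    have := Module.rank_lt_aleph0 ℚ ℝ
    rw [Real.rank_rat_real] at this
    exact absurd this (not_lt.2 Cardinal.aleph0_le_continuum)
  let ℓ (s : Set I) : ℝ →ₗ[ℚ] ℚ := (b.constr ℚ fun i => if i ∈ s then (1 : ℚ) else 0) ∘ₗ R.mkQ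
  have hℓ (s : Set I) (q : ℚ) : ℓ s q = 0 := by
    have : (q : ℝ) ∈ R := by
      refine Submodule.mem_span_singleton.2 ⟨q, ?_⟩
      rw [Rat.smul_def, mul_one]
    simp only [ℓ, LinearMap.comp_apply, Submodule.mkQ_apply, (Submodule.Quotient.mk_eq_zero R).2 this,
      map_zero]
  have hx (i : I) : ∃ x : ℝ, ∀ s : Set I, ∀ n : ℕ,
      ℓ s (x / n) = if i ∈ s then (1 / n : ℚ) else 0 := by
    obtain ⟨x, hx⟩ := R.mkQ_surjective (b i)
    refine ⟨x, fun s n => ?_⟩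
    have : x / n = (1 / n : ℚ) • x := by
      rw [Rat.smul_def]; push_cast; ring
    rw [this, map_smul]
    simp only [ℓ, LinearMap.comp_apply, hx, Module.Basis.constr_basis]
    split_ifs <;> simp
  let T (s : Set I) : CircleExtension.{u} :=
    twist (χ.comp (ℓ s).toAddMonoidHom)
      (fun q => (congrArg χ (hℓ s q)).trans (map_zero χ)) (fun x => htor (ℓ s x))
  have hT (s t : Set I) (hst : (T s).Iso₀ (T t)) : s = t := by
    ext i
    obtain ⟨x, hx⟩ := hx i
    obtain ⟨q, hq⟩ := exists_rat_of_iso₀_twist hst x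
    replace hq (n : ℕ) (hn : n ≠ 0) :
        χ (ℓ s (x / n)) - χ (ℓ t (x / n)) = ((q / n : ℝ) : UnitAddCircle) := hq n hn
    simp only [hx] at hq
    by_cases hs : i ∈ s <;> by_cases ht : i ∈ t <;> simp only [hs, ht, if_true, if_false] at hq ⊢
    · simp only [map_zero, sub_zero] at hq
      exact absurd hq <| not_forall_triadic_character_eq h3 h2 q
    · simp only [map_zero, zero_sub] at hq
      refine absurd ?_ (not_forall_triadic_character_eq h3 h2 (-q))
      intro n hn
      rw [← neg_neg (χ _), hq n hn, ← AddCircle.coe_neg, Rat.cast_neg, neg_div]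
  have hTinj : Function.Injective T := fun s t hst => hT s t (by
    rw [hst, iso₀_iff_range_piHat])
  refine ⟨Set.range T, ?_, ?_, ?_⟩
  · have h1 := Cardinal.mk_range_eq_of_injective hTinj
    have h2 : (2 : Cardinal.{u + 1}) ^ Cardinal.aleph0 ≤ Cardinal.lift.{u + 1} (Cardinal.mk (Set I)) := by
      rw [Cardinal.mk_set, Cardinal.lift_two_power]
      exact Cardinal.power_le_power_left two_ne_zero
        (by simp)
    rw [← h1] at h2
    simpa using h2
  · rintro _ ⟨s, rfl⟩
    exact twist_elemEquiv_standard
  · rintro _ ⟨s, rfl⟩ _ ⟨t, rfl⟩ hne hiso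
    exact hne (congrArg T (hT s t hiso))

end CircleExtension

theorem theorem3p12 :
    -- (1)
    (∀ E : CircleExtension.{u},
      E.ElemEquiv CircleExtension.standard ↔
        ∀ n : ℕ+, E.π (E.divBy (E.ι 1) n) = ((1 / (n : ℕ) : ℝ) : UnitAddCircle)) ∧
    -- (2), without and with a named generator, and the number of isomorphism types
    ((∀ (E : CircleExtension.{u}) (E' : CircleExtension.{v}),
        (E.Iso₀ E' ↔ Set.range E.piHat = Set.range E'.piHat) ∧
        (E.Iso E' ↔ Set.range E.piHat = Set.range E'.piHat ∧
          E.piHat (E.ι 1) = E'.piHat (E'.ι 1))) ∧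
      ∃ S : Set CircleExtension.{u},
        (2 : Cardinal) ^ Cardinal.aleph0 ≤ Cardinal.mk S ∧
        (∀ E ∈ S, E.ElemEquiv CircleExtension.standard) ∧
        S.Pairwise fun E E' => ¬ E.Iso₀ E') ∧
    -- (3), without and with a named generator
    (∀ E : CircleExtension.{u},
      (E.Iso₀ CircleExtension.standard ↔
        ∃ _ : TopologicalSpace E.G, IsTopologicalAddGroup E.G ∧ IsCoveringMap E.π) ∧
      (E.Iso CircleExtension.standard ↔
        (∃ _ : TopologicalSpace E.G, IsTopologicalAddGroup E.G ∧ IsCoveringMap E.π) ∧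
        ∀ n : ℕ+, E.π (E.divBy (E.ι 1) n) = ((1 / (n : ℕ) : ℝ) : UnitAddCircle))) := by
  open CircleExtension in
  exact ⟨fun E => elemEquiv_standard_iff,
    ⟨fun E E' => ⟨iso₀_iff_range_piHat, iso_iff_range_piHat⟩, exists_many_twists⟩,
    fun E => ⟨iso₀_standard_iff, iso_standard_iff⟩⟩
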